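/- For a finite group $G$, let $d(G)$ be its minimal number of generators and $\Phi(G)$ its Frattini subgroup. A power automorphism of $G$ is an automorphism mapping every subgroup of $G$ to itself. For primes $p,q$ and a positive integer $d$, a maximal $(p,q)$-pair of rank $d$ is a pair $(P,\alpha)$, where $P$ is a finite $p$-group and $\alpha\in\mathrm{Aut}(P)$ has prime order $q$ dividing $p-1$, such that (a) $d(H)\le d(P)=d$ for every subgroup $H$ of $P$; (b) the image of $\alpha$ in $\mathrm{Aut}(P/\Phi(P))$ is a non-trivial power automorphism; (c) if $H$ is a proper subgroup of $P$ with $d(H)=d(P)$, then either $\alpha(H)\ne H$ or the image of $\alpha$ in $\mathrm{Aut}(H/\Phi(H))$ is not a non-trivial power automorphism. **Proposition.** Let $(P,\alpha)$ be a maximal $(3,q)$-pair of rank $2$. Then $P$ is isomorphic to one of the following: (1) an elementary abelian group of order $9$; (2) an extraspecial group of order $27$ and exponent $3$; (3) the group $\mathtt{SmallGroup(81,10)}$ of order $81$, that is, with $[x,y]=x^{-1}y^{-1}xy$, $$\langle b,c,d,e \mid b^3=c^3=e^2,\ d^3=e^3=1,\ [c,b]=d,\ [d,b]=e,\ [d,c]=[e,b]=[e,c]=[e,d]=1\rangle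 .$$ -/

import Mathlib

section MaximalPairs

variable {G : Type*} [Group G]

/-- A power automorphism of a group: an automorphism mapping every subgroup to itself. -/
def IsPowerAut (φ : MulAut G) : Prop :=
  ∀ K : Subgroup G, K.map φ.toMonoidHom = K

/-- The image of an automorphism `α` of `G` in `Aut(G/Φ(G))`. -/
def frattiniAut (α : MulAut G) : MulAut (G ⧸ frattini G) :=
  QuotientGroup.congr (frattini G) (frattini G) α
    (Subgroup.characteristic_iff_map_eq.mp inferInstance α)

/-- The automorphism `α` induces a non-trivial power automorphism of `G/Φ(G)`. -/
def IsNontrivialPowerOnFrattini (α : MulAut G) : Prop :=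
  frattiniAut α ≠ 1 ∧ IsPowerAut (frattiniAut α)

/-- The restriction of an automorphism `α` to a subgroup `H` with `α(H) = H`. -/
def restrictAut (α : MulAut G) (H : Subgroup G) (h : H.map α.toMonoidHom = H) : MulAut H :=
  (MulEquiv.subgroupMap α H).trans (MulEquiv.subgroupCongr h)

/-- `(P, α)` is a maximal `(p, q)`-pair of rank `d`. Here `Group.rank` is the minimal number of
generators. -/
structure IsMaximalPair (p q d : ℕ) (P : Type*) [Group P] [Finite P] (α : MulAut P) : Prop where
  prime_p : p.Prime
  prime_q : q.Prime
  isPGroup : IsPGroup p P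
  orderOf_eq : orderOf α = q
  q_dvd : q ∣ p - 1
  rank_eq : Group.rank P = d
  rank_le : ∀ H : Subgroup P, Group.rank H ≤ Group.rank P
  power : IsNontrivialPowerOnFrattini α
  maximal : ∀ H : Subgroup P, H < ⊤ → Group.rank H = Group.rank P →
    ∀ h : H.map α.toMonoidHom = H, ¬ IsNontrivialPowerOnFrattini (restrictAut α H h)

end MaximalPairs

/-- Elementary abelian `p`-groups: abelian groups all of whose elements `x` satisfy `x ^ p = 1`. -/
def IsElementaryAbelianGroup (p : ℕ) (G : Type*) [Group G] : Prop :=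
  (∀ x y : G, x * y = y * x) ∧ ∀ x : G, x ^ p = 1

/-- Extraspecial `p`-groups: `Z(G) = [G, G] = Φ(G)` has order `p`. -/
structure IsExtraspecialGroup (p : ℕ) (G : Type*) [Group G] : Prop where
  isPGroup : IsPGroup p G
  card_center : Nat.card (Subgroup.center G) = p
  commutator_eq : commutator G = Subgroup.center G
  frattini_eq : frattini G = Subgroup.center G

namespace SmallGroup81x10

/-- The commutator `[x, y] = x⁻¹ y⁻¹ x y` (not Mathlib's `⁅x, y⁆ = x y x⁻¹ y⁻¹`). -/
def comm {G : Type*} [Group G] (x y : G) : G := x⁻¹ * y⁻¹ * x * y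

def b : FreeGroup (Fin 4) := FreeGroup.of 0
def c : FreeGroup (Fin 4) := FreeGroup.of 1
def d : FreeGroup (Fin 4) := FreeGroup.of 2
def e : FreeGroup (Fin 4) := FreeGroup.of 3

/-- The relators of the presentation
`b³ = e²`, `c³ = e²`, `d³ = e³ = 1`, `[c, b] = d`, `[d, b] = e`, `[d, c] = 1`,
`[e, b] = [e, c] = [e, d] = 1`. -/
def rels : Set (FreeGroup (Fin 4)) :=
  {b ^ 3 * (e ^ 2)⁻¹, c ^ 3 * (e ^ 2)⁻¹, d ^ 3, e ^ 3,
    comm c b * d⁻¹, comm d b * e⁻¹, comm d c, comm e b, comm e c, comm e d}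

end SmallGroup81x10

/-- The group of order 81 with identifier (81, 10) in the `SmallGroup` library, given by its
polycyclic presentation. -/
abbrev SmallGroup81_10 : Type := PresentedGroup SmallGroup81x10.rels

/-!
The order of `α` is two, and `α` inverts `P / Φ(P)`. Call `u` inverted if `α u = u⁻¹`. Since
`α g * g⁻¹` is always inverted and lies in the coset `g Φ(P)`, every such coset contains an inverted
element, and `P` has a pair of inverted generators `x`, `y`. Two inverted elements
generate an `α`-invariant subgroup on whose Frattini quotient `α` acts as inversion, so by maximality
they generate `P` or a cyclic subgroup (`IsMaximalPair.isInvertingPair`). Everything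
else follows from this dichotomy.

An inverted element `w` of `Φ(P)` cannot generate the non-cyclic group `P` together with one other
element, so it lies in a common cyclic subgroup with every inverted element. Hence it is central,
and it is a power of `u ^ 3` for every inverted `u` outside `Φ(P)`
(`IsInvertingPair.mem_zpowers_cube`). In particular `x ^ 3` and `y ^ 3` are central, and `α` acts
trivially on `Φ(P)` modulo the center. For `d = [y, x]` this makes `e = [d, x]` and `[d, y]`
central and inverted (`IsInvertedGenerators.gcomm_gcomm_mem_center`), and the cubes of `d`, `e`
and `[d, y]` are trivial. As `e` and `[d, y]` lie in a common cyclic subgroup, a change of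
generators achieves `[d, y] = 1`. The palindromes `y ^ n * x * y ^ n` are again inverted and can
replace `x`; their cubes are `x ^ 3 * y ^ (6 * n) * e ^ (2 * n)`
(`IsNormalizedGenerators.cube_palindrome`).

If `e = 1`, some palindrome has trivial cube, which forces `y ^ 3 = 1`, and `P` has class at most
two and two generators of order three (`IsPGroup.classification_of_gcomm_mem_center`). If `e ≠ 1`,
one may assume that `x ^ 3` is a power of `e`, and since no palindrome has trivial cube,
`y ^ 3 = e ^ 2` and, after replacing `x` by its inverse if necessary, `x ^ 3 = e ^ 2`
(`IsNormalizedGenerators.exists_cube_eq_sq`). These are the relations of the group of order `81`,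
and a normal form shows that they define `P`.
-/

-- `gcomm x y` is `x⁻¹ * y⁻¹ * x * y`; the name `comm` alone would clash with Mathlib's `comm`.
open SmallGroup81x10 renaming comm → gcomm
open scoped commutatorElement

/-! ### Frattini quotients of finite `p`-groups -/

theorem gcomm_eq_one_iff_commute {G : Type*} [Group G] {x y : G} :
    gcomm x y = 1 ↔ Commute x y := by
  rw [gcomm, mul_assoc, ← mul_inv_rev, inv_mul_eq_one, eq_comm]
  rfl

theorem map_gcomm {G H : Type*} [Group G] [Group H] (f : G →* H) (x y : G) :
    f (gcomm x y) = gcomm (f x) (f y) := by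
  simp [gcomm]

/-- The quotient by a normal maximal subgroup is generated by each of its non-trivial elements. -/
theorem Subgroup.zpowers_mk_eq_top_of_isCoatom {G : Type*} [Group G] {M : Subgroup G}
    [M.Normal] (hM : IsCoatom M) {g : G ⧸ M} (hg : g ≠ 1) : Subgroup.zpowers g = ⊤ := by
  have hinj := Subgroup.comap_injective (QuotientGroup.mk'_surjective M)
  apply hinj
  rw [Subgroup.comap_top]
  apply hM.2
  obtain ⟨x, rfl⟩ := QuotientGroup.mk'_surjective M g
  refine lt_of_le_of_ne (fun m hm => ?_) fun h => hg ?_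
  · have h1 : QuotientGroup.mk' M m = 1 := (QuotientGroup.eq_one_iff m).mpr hm
    rw [Subgroup.mem_comap, h1]
    exact one_mem _
  · have : x ∈ M := by
      rw [h]
      exact Subgroup.mem_zpowers _
    exact (QuotientGroup.eq_one_iff x).mpr this

namespace IsPGroup

variable {p : ℕ} [Fact p.Prime] {G : Type*} [Group G]

theorem mem_zpowers_zpow (hG : IsPGroup p G) (g : G) {n : ℤ} (hn : ¬ (p : ℤ) ∣ n) :
    g ∈ Subgroup.zpowers (g ^ n) := by
  obtain ⟨k, hk⟩ := hG g
  have hp : Prime (p : ℤ) := Nat.prime_iff_prime_int.mp Fact.out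
  obtain ⟨a, b, hab⟩ : IsCoprime n ((p : ℤ) ^ k) :=
    (((Prime.coprime_iff_not_dvd hp).mpr hn).symm).pow_right
  refine ⟨a, ?_⟩
  have hk' : g ^ ((p : ℤ) ^ k) = 1 := by exact_mod_cast hk
  calc (g ^ n) ^ a = g ^ (a * n + b * (p : ℤ) ^ k) := by
        rw [zpow_add, zpow_mul' g b, hk', mul_comm a, zpow_mul]; simp
    _ = g := by rw [hab, zpow_one]

theorem eq_one_of_zpow_eq_one (hG : IsPGroup p G) {g : G} {n : ℤ} (hn : ¬ (p : ℤ) ∣ n)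
    (h : g ^ n = 1) : g = 1 := by
  have := hG.mem_zpowers_zpow g hn
  rwa [h, Subgroup.zpowers_one_eq_bot, Subgroup.mem_bot] at this

variable [Finite G]

theorem normal_of_isCoatom (hG : IsPGroup p G) {M : Subgroup G} (hM : IsCoatom M) : M.Normal :=
  haveI := hG.isNilpotent
  Subgroup.NormalizerCondition.normal_of_coatom M Group.normalizerCondition_of_isNilpotent hM

theorem pow_mem_frattini (hG : IsPGroup p G) (g : G) : g ^ p ∈ frattini G := by
  simp only [frattini, Order.radical, Subgroup.mem_iInf]
  intro M hM
  have := hG.normal_of_isCoatom hM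
  rw [← QuotientGroup.eq_one_iff, QuotientGroup.mk_pow]
  by_contra hg
  obtain ⟨k, hk⟩ : (g : G ⧸ M) ∈ Subgroup.zpowers ((g : G ⧸ M) ^ p) := by
    rw [Subgroup.zpowers_mk_eq_top_of_isCoatom hM hg]; trivial
  have h1 : (g : G ⧸ M) ^ ((p : ℤ) * k - 1) = 1 := by
    rw [zpow_sub_one, zpow_mul, zpow_natCast, mul_inv_eq_one]
    exact hk
  have h2 : ¬ (p : ℤ) ∣ p * k - 1 := by
    intro h
    have := (dvd_sub_right (Dvd.intro k rfl)).mp h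
    exact (Nat.prime_iff_prime_int.mp (Fact.out : p.Prime)).not_dvd_one this
  exact hg (by rw [(hG.to_quotient M).eq_one_of_zpow_eq_one h2 h1, one_pow])

theorem gcomm_mem_frattini (hG : IsPGroup p G) (x y : G) : gcomm x y ∈ frattini G := by
  simp only [frattini, Order.radical, Subgroup.mem_iInf]
  intro M hM
  have := hG.normal_of_isCoatom hM
  by_cases hx : (x : G ⧸ M) = 1
  · rw [← QuotientGroup.eq_one_iff, ← QuotientGroup.mk'_apply, map_gcomm,
      gcomm_eq_one_iff_commute, QuotientGroup.mk'_apply, hx]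
    exact Commute.one_left _
  · obtain ⟨k, hk⟩ : (y : G ⧸ M) ∈ Subgroup.zpowers (x : G ⧸ M) := by
      rw [Subgroup.zpowers_mk_eq_top_of_isCoatom hM hx]; trivial
    rw [← QuotientGroup.eq_one_iff, ← QuotientGroup.mk'_apply, map_gcomm,
      gcomm_eq_one_iff_commute, QuotientGroup.mk'_apply, QuotientGroup.mk'_apply, ← hk]
    exact Commute.zpow_right rfl k

theorem frattini_quotient_pow (hG : IsPGroup p G) (a : G ⧸ frattini G) : a ^ p = 1 := by
  obtain ⟨x, rfl⟩ := QuotientGroup.mk_surjective a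
  rw [← QuotientGroup.mk_pow, QuotientGroup.eq_one_iff]
  exact hG.pow_mem_frattini x

theorem frattini_quotient_commute (hG : IsPGroup p G) (a b : G ⧸ frattini G) : Commute a b := by
  obtain ⟨x, rfl⟩ := QuotientGroup.mk'_surjective _ a
  obtain ⟨y, rfl⟩ := QuotientGroup.mk'_surjective _ b
  rw [← gcomm_eq_one_iff_commute, ← map_gcomm]
  exact (QuotientGroup.eq_one_iff _).mpr (hG.gcomm_mem_frattini x y)

end IsPGroup

theorem frattini_ne_top (G : Type*) [Group G] [Finite G] [Nontrivial G] : frattini G ≠ ⊤ := by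
  intro h
  exact bot_ne_top (frattini_nongenerating (G := G) (K := ⊥) (by rw [h, sup_top_eq]))

/-- Frattini elements are non-generators, so a pair containing one could only generate a cyclic
group. -/
theorem closure_pair_ne_top_of_mem_frattini {G : Type*} [Group G] [Finite G] (hG : ¬ IsCyclic G)
    {w v : G} (hw : w ∈ frattini G) : Subgroup.closure {w, v} ≠ ⊤ := by
  intro h
  apply hG
  have : Subgroup.zpowers v = ⊤ := by
    apply frattini_nongenerating
    rw [eq_top_iff, ← h, Subgroup.closure_le]
    rintro g (rfl | rfl)
    · exact Subgroup.mem_sup_right hw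
    · exact Subgroup.mem_sup_left (Subgroup.mem_zpowers _)
  exact ⟨v, fun g => (this ▸ Subgroup.mem_top g : g ∈ Subgroup.zpowers v)⟩

/-! ### Consequences of the maximality of a pair -/

theorem isCyclic_of_rank_le_one {G : Type*} [Group G] [Group.FG G] (h : Group.rank G ≤ 1) :
    IsCyclic G := by
  obtain ⟨S, hS, hcl⟩ := Group.rank_spec G
  obtain ⟨g, hg⟩ := Finset.card_le_one_iff_subset_singleton.mp (hS.trans_le h)
  refine ⟨g, fun x => ?_⟩
  have hx : x ∈ Subgroup.closure (S : Set G) := hcl ▸ Subgroup.mem_top x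
  have := Subgroup.closure_mono (Finset.coe_subset.mpr hg) hx
  rwa [Finset.coe_singleton, ← Subgroup.zpowers_eq_closure] at this

theorem IsCyclic.rank_le_one {G : Type*} [Group G] [Group.FG G] [IsCyclic G] :
    Group.rank G ≤ 1 := by
  obtain ⟨g, hg⟩ := IsCyclic.exists_generator (α := G)
  refine (Group.rank_le (S := {g}) ?_).trans (Finset.card_singleton g).le
  rw [Finset.coe_singleton, ← Subgroup.zpowers_eq_closure, Subgroup.eq_top_iff']
  exact hg

/-- On a group of exponent three the only non-trivial power automorphism is inversion: each element
is fixed or inverted, and if `a` were fixed and `b` inverted, then the subgroup generated by `a * b`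
would not be preserved. -/
theorem IsPowerAut.apply_eq_inv {A : Type*} [Group A] (hcomm : ∀ a b : A, Commute a b)
    (hexp : ∀ a : A, a ^ 3 = 1) {φ : MulAut A} (hφ : IsPowerAut φ) (hne : φ ≠ 1) (a : A) :
    φ a = a⁻¹ := by
  have hsq (a : A) : a ^ 2 = a⁻¹ := by
    rw [eq_inv_iff_mul_eq_one, ← pow_succ, hexp]
  have hor (a : A) : φ a = 1 ∨ φ a = a ∨ φ a = a⁻¹ := by
    have h1 : φ a ∈ (Subgroup.zpowers a).map φ.toMonoidHom :=
      ⟨a, Subgroup.mem_zpowers a, rfl⟩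
    rw [hφ] at h1
    obtain ⟨k, hk⟩ := h1
    have hk : a ^ k = φ a := hk
    have hk' : a ^ k = a ^ (k % 3) := by
      conv_lhs => rw [← Int.mul_ediv_add_emod k 3, zpow_add, zpow_mul]
      rw [show a ^ (3 : ℤ) = 1 from mod_cast hexp a, one_zpow, one_mul]
    have : k % 3 = 0 ∨ k % 3 = 1 ∨ k % 3 = 2 := by omega
    rw [← hk, hk']
    rcases this with h | h | h <;> rw [h]
    · left; simp
    · right; left; simp
    · right; right; rw [← hsq]; exact mod_cast rfl
  have hone {a : A} (h : a = a⁻¹) : a = 1 := by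
    have h3 := hexp a
    rw [pow_succ, hsq, ← h] at h3
    have h2 := hsq a
    rw [pow_two, h3] at h2
    exact (inv_eq_one.mp h2.symm)
  obtain ⟨b, hb⟩ : ∃ b, φ b ≠ b := by
    by_contra! h
    exact hne (MulEquiv.ext h)
  have hb1 : b ≠ 1 := fun h => hb (by rw [h, map_one])
  have hbi : φ b = b⁻¹ := by
    rcases hor b with h | h | h
    · exact absurd ((map_eq_one_iff φ φ.injective).mp h) hb1
    · exact absurd h hb
    · exact h
  rcases hor a with h | h | h
  · have := (map_eq_one_iff φ φ.injective).mp h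
    rw [this, map_one, inv_one]
  · have hab : φ (a * b) = a * b⁻¹ := by rw [map_mul, h, hbi]
    rcases hor (a * b) with h' | h' | h'
    · have h1 := (map_eq_one_iff φ φ.injective).mp h'
      rw [h', eq_comm, mul_inv_eq_one] at hab
      rw [hab] at h1 ⊢
      exact hbi
    · rw [h', mul_right_inj] at hab
      exact absurd (hone hab) hb1
    · rw [h', mul_inv_rev, (hcomm _ _).eq, mul_left_inj] at hab
      rw [h, hab]
  · exact h

@[simp]
theorem frattiniAut_mk {G : Type*} [Group G] (β : MulAut G) (g : G) :
    frattiniAut β (g : G ⧸ frattini G) = (β g : G ⧸ frattini G) := rfl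

theorem IsPGroup.frattiniAut_eq_inv_of_closure {p : ℕ} [Fact p.Prime] {G : Type*} [Group G]
    [Finite G] (hG : IsPGroup p G) {S : Set G} (hS : Subgroup.closure S = ⊤) {β : MulAut G}
    (hβ : ∀ s ∈ S, β s = s⁻¹) (a : G ⧸ frattini G) : frattiniAut β a = a⁻¹ := by
  obtain ⟨g, rfl⟩ := QuotientGroup.mk_surjective a
  have hg : g ∈ Subgroup.closure S := hS ▸ Subgroup.mem_top g
  induction hg using Subgroup.closure_induction with
  | mem s hs => rw [frattiniAut_mk, hβ s hs, QuotientGroup.mk_inv]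
  | one => simp only [QuotientGroup.mk_one, map_one, inv_one]
  | mul x y _ _ hx hy =>
    rw [QuotientGroup.mk_mul, map_mul, hx, hy, mul_inv_rev]
    exact (hG.frattini_quotient_commute _ _).eq
  | inv x _ hx => rw [QuotientGroup.mk_inv, map_inv, hx]

theorem IsPGroup.isNontrivialPowerOnFrattini {p : ℕ} [Fact p.Prime] (hp : p ≠ 2) {G : Type*}
    [Group G] [Finite G] [Nontrivial G] (hG : IsPGroup p G) {β : MulAut G}
    (hβ : ∀ a, frattiniAut β a = a⁻¹) : IsNontrivialPowerOnFrattini β := by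
  constructor
  · intro h
    apply frattini_ne_top G
    rw [Subgroup.eq_top_iff']
    intro g
    rw [← QuotientGroup.eq_one_iff]
    have h1 := hβ g
    rw [h, MulAut.one_apply, eq_inv_iff_mul_eq_one] at h1
    refine (hG.to_quotient _).eq_one_of_zpow_eq_one (n := 2) ?_ ((zpow_two _).trans h1)
    rw [show (2 : ℤ) = (2 : ℕ) from rfl, Int.natCast_dvd_natCast,
      Nat.prime_dvd_prime_iff_eq Fact.out Nat.prime_two]
    exact hp
  · intro K
    ext a
    constructor
    · rintro ⟨b, hb, rfl⟩
      change frattiniAut β b ∈ K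
      rw [hβ]
      exact K.inv_mem hb
    · intro ha
      refine ⟨a⁻¹, K.inv_mem ha, ?_⟩
      change frattiniAut β a⁻¹ = a
      rw [hβ, inv_inv]

/-- The properties of a maximal `(3, q)`-pair of rank two from which the classification is derived,
stated through elements `u` inverted by `α`, that is, `α u = u⁻¹`. -/
structure IsInvertingPair {P : Type*} [Group P] (α : MulAut P) : Prop where
  isPGroup : IsPGroup 3 P
  not_isCyclic : ¬ IsCyclic P
  apply_apply : ∀ g, α (α g) = g
  dichotomy : ∀ u v, α u = u⁻¹ → α v = v⁻¹ → Subgroup.closure {u, v} = ⊤ ∨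
    ∃ g, u ∈ Subgroup.zpowers g ∧ v ∈ Subgroup.zpowers g

/-- Two elements inverted by `α` that generate the group. -/
structure IsInvertedGenerators {P : Type*} [Group P] (α : MulAut P) (x y : P) : Prop where
  closure_eq_top : Subgroup.closure {x, y} = ⊤
  apply_left : α x = x⁻¹
  apply_right : α y = y⁻¹

namespace IsMaximalPair

variable {P : Type*} [Group P] [Finite P] {q : ℕ} {α : MulAut P}

theorem isInvertingPair (h : IsMaximalPair 3 q 2 P α) : IsInvertingPair α where
  isPGroup := h.isPGroup
  not_isCyclic hc := by
    have := h.rank_eq ▸ hc.rank_le_one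
    omega
  apply_apply g := by
    have hq : q = 2 := (Nat.prime_dvd_prime_iff_eq h.prime_q Nat.prime_two).mp h.q_dvd
    have h1 := pow_orderOf_eq_one α
    rw [h.orderOf_eq, hq, pow_two] at h1
    exact DFunLike.congr_fun h1 g
  dichotomy u v hu hv := by
    rw [or_iff_not_imp_left]
    intro hne
    set H := Subgroup.closure {u, v} with hH
    have huH : u ∈ H := Subgroup.subset_closure (by simp)
    have hvH : v ∈ H := Subgroup.subset_closure (by simp)
    have hmap : H.map α.toMonoidHom = H := by
      apply Subgroup.eq_of_le_of_card_ge
      · rw [hH, MonoidHom.map_closure, Subgroup.closure_le]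
        rintro _ ⟨s, rfl | rfl, rfl⟩
        · exact (congrArg (· ∈ H) hu).mpr (H.inv_mem huH)
        · exact (congrArg (· ∈ H) hv).mpr (H.inv_mem hvH)
      · exact (Subgroup.card_map_of_injective α.injective).ge
    suffices hc : IsCyclic H by
      obtain ⟨⟨g, _⟩, hg⟩ := hc
      obtain ⟨a, ha⟩ := hg ⟨u, huH⟩
      obtain ⟨b, hb⟩ := hg ⟨v, hvH⟩
      exact ⟨g, ⟨a, congrArg Subtype.val ha⟩, ⟨b, congrArg Subtype.val hb⟩⟩
    apply isCyclic_of_rank_le_one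
    have hle := h.rank_le H
    by_contra! hlt
    have hrank : Group.rank H = Group.rank P := by have := h.rank_eq; omega
    have : Nontrivial H := by
      by_contra hn
      rw [not_nontrivial_iff_subsingleton] at hn
      rw [Group.rank_eq_zero] at hlt
      omega
    have hp : Fact (Nat.Prime 3) := ⟨Nat.prime_three⟩
    have hH3 := h.isPGroup.to_subgroup H
    refine h.maximal H (lt_top_iff_ne_top.mpr hne) hrank hmap
      (hH3.isNontrivialPowerOnFrattini (by norm_num)
        (hH3.frattiniAut_eq_inv_of_closure (Subgroup.closure_closure_coe_preimage) ?_))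
    rintro ⟨s, hs⟩ (hs' | hs')
    · exact Subtype.ext ((congrArg α hs').trans (hu.trans (congrArg _ hs'.symm)))
    · exact Subtype.ext ((congrArg α hs').trans (hv.trans (congrArg _ hs'.symm)))

theorem exists_isInvertedGenerators (h : IsMaximalPair 3 q 2 P α) :
    ∃ x y, IsInvertedGenerators α x y := by
  classical
  have hp : Fact (Nat.Prime 3) := ⟨Nat.prime_three⟩
  have hα := h.isInvertingPair
  have hinv (g : P) : (α g : P ⧸ frattini P) = (g : P ⧸ frattini P)⁻¹ :=
    h.power.2.apply_eq_inv h.isPGroup.frattini_quotient_commute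
      h.isPGroup.frattini_quotient_pow h.power.1 (g : P ⧸ frattini P)
  -- Every coset of the Frattini subgroup contains an inverted element.
  have hex (g : P) : ∃ u, α u = u⁻¹ ∧ (u : P ⧸ frattini P) = g := by
    refine ⟨α g * g⁻¹, by rw [map_mul, hα.apply_apply, map_inv, mul_inv_rev, inv_inv], ?_⟩
    rw [QuotientGroup.mk_mul, QuotientGroup.mk_inv, hinv, ← mul_inv_rev, inv_eq_iff_mul_eq_one,
      ← pow_two, ← pow_succ]
    exact h.isPGroup.frattini_quotient_pow _
  obtain ⟨S, hS, hcl⟩ := Group.rank_spec P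
  rw [h.rank_eq] at hS
  obtain ⟨a, b, -, rfl⟩ := Finset.card_eq_two.mp hS
  obtain ⟨x, hx, hxa⟩ := hex a
  obtain ⟨y, hy, hyb⟩ := hex b
  refine ⟨x, y, frattini_nongenerating ?_, hx, hy⟩
  rw [eq_top_iff, ← hcl, Subgroup.closure_le]
  have key {s t : P} (ht : t ∈ ({x, y} : Set P)) (hst : (t : P ⧸ frattini P) = s) :
      s ∈ Subgroup.closure {x, y} ⊔ frattini P := by
    rw [← mul_inv_cancel_left t s]
    exact Subgroup.mul_mem_sup (Subgroup.subset_closure ht) (QuotientGroup.eq.mp hst)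
  intro s hs
  rw [Finset.coe_pair] at hs
  rcases hs with rfl | rfl
  · exact key (by simp) hxa
  · exact key (by simp) hyb

end IsMaximalPair

/-! ### Inverted elements -/

theorem Subgroup.mem_center_of_closure_pair {G : Type*} [Group G] {x y w : G}
    (h : Subgroup.closure {x, y} = ⊤) (hx : Commute w x) (hy : Commute w y) :
    w ∈ Subgroup.center G := by
  rw [Subgroup.mem_center_iff]
  intro g
  have hg : g ∈ Subgroup.closure {x, y} := h ▸ Subgroup.mem_top g
  have hle : Subgroup.closure {x, y} ≤ Subgroup.centralizer {w} := by
    rw [Subgroup.closure_le]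
    rintro _ (rfl | rfl) <;> rw [SetLike.mem_coe, Subgroup.mem_centralizer_singleton_iff]
    · exact hx.symm
    · exact hy.symm
  exact Subgroup.mem_centralizer_singleton_iff.mp (hle hg)

theorem Commute.of_mem_center {G : Type*} [Group G] {z : G} (hz : z ∈ Subgroup.center G) (g : G) :
    Commute z g :=
  (Subgroup.mem_center_iff.mp hz g).symm

/-- Conjugation by `X` inverts `E`; conjugating three times gives `E = E⁻¹`. -/
theorem sq_eq_one_of_conj_inv_eq {G : Type*} [Group G] {X E : G} (hX : X ^ 3 = 1)
    (h : X * E⁻¹ * X⁻¹ = E) : E ^ 2 = 1 := by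
  have h1 : X * E * X⁻¹ = E⁻¹ := by
    have := congrArg (·⁻¹) h
    simpa only [mul_inv_rev, inv_inv, mul_assoc] using this
  have h2 : X ^ 3 * E * (X ^ 3)⁻¹ = E⁻¹ := by
    have h3 : X ^ 3 * E * (X ^ 3)⁻¹ = X * (X * (X * E * X⁻¹) * X⁻¹) * X⁻¹ := by
      simp only [pow_succ, pow_zero, one_mul, mul_inv_rev, mul_assoc]
    rw [h3, h1, h, h1]
  rw [hX, one_mul, inv_one, mul_one] at h2
  rw [pow_two]
  nth_rw 1 [h2]
  exact inv_mul_cancel E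

namespace IsInvertingPair

variable {P : Type*} [Group P] [Finite P] {α : MulAut P}

/-- An inverted Frattini element lies in a common cyclic subgroup with each inverted generator. -/
theorem mem_center_of_mem_frattini (hα : IsInvertingPair α) {x y w : P}
    (hxy : IsInvertedGenerators α x y) (hw : w ∈ frattini P) (hαw : α w = w⁻¹) :
    w ∈ Subgroup.center P := by
  have key (v : P) (hv : α v = v⁻¹) : Commute w v := by
    obtain h | ⟨g, ⟨a, rfl⟩, ⟨b, rfl⟩⟩ := hα.dichotomy w v hαw hv
    · exact absurd h (closure_pair_ne_top_of_mem_frattini hα.not_isCyclic hw)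
    · exact Commute.zpow_zpow_self g a b
  exact Subgroup.mem_center_of_closure_pair hxy.closure_eq_top (key x hxy.apply_left)
    (key y hxy.apply_right)

/-- An inverted element of the Frattini subgroup generates a cyclic group together with any inverted
element `u`, and in that cyclic `3`-group it cannot generate more than `u ^ 3` does. -/
theorem mem_zpowers_cube (hα : IsInvertingPair α) {w u : P} (hw : w ∈ frattini P)
    (hαw : α w = w⁻¹) (hu : u ∉ frattini P) (hαu : α u = u⁻¹) :
    w ∈ Subgroup.zpowers (u ^ 3) := by
  have hp : Fact (Nat.Prime 3) := ⟨Nat.prime_three⟩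
  obtain h | ⟨g, ⟨a, rfl⟩, ⟨b, rfl⟩⟩ := hα.dichotomy w u hαw hαu
  · exact absurd h (closure_pair_ne_top_of_mem_frattini hα.not_isCyclic hw)
  dsimp only at *
  by_cases hb : ((3 : ℕ) : ℤ) ∣ b
  · obtain ⟨c, rfl⟩ := hb
    refine absurd ?_ hu
    rw [zpow_mul']
    exact mod_cast hα.isPGroup.pow_mem_frattini (g ^ c)
  by_cases ha : ((3 : ℕ) : ℤ) ∣ a
  · obtain ⟨c, rfl⟩ := ha
    have h1 := Subgroup.zpow_mem _ (hα.isPGroup.mem_zpowers_zpow g hb) c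
    obtain ⟨k, hk⟩ := h1
    refine ⟨k, ?_⟩
    dsimp only at hk ⊢
    rw [zpow_mul', ← hk]
    simp only [← zpow_natCast, ← zpow_mul]
    congr 1
    ring
  · refine absurd ?_ hu
    have h1 := hα.isPGroup.mem_zpowers_zpow g ha
    exact Subgroup.zpow_mem _ (Subgroup.zpowers_le.mpr hw h1) b

/-- On the Frattini subgroup `α` acts trivially modulo the center, because
`α g * g⁻¹` is inverted. -/
theorem apply_eq_mul_center (hα : IsInvertingPair α) {x y g : P}
    (hxy : IsInvertedGenerators α x y) (hg : g ∈ frattini P) :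
    ∃ z ∈ Subgroup.center P, α g = z * g := by
  refine ⟨α g * g⁻¹, hα.mem_center_of_mem_frattini hxy ?_ ?_, by rw [inv_mul_cancel_right]⟩
  · refine mul_mem ?_ (inv_mem hg)
    have := Subgroup.characteristic_iff_map_eq.mp (frattini_characteristic (G := P)) α
    exact this ▸ Subgroup.mem_map_of_mem α.toMonoidHom hg
  · rw [map_mul, hα.apply_apply, map_inv, mul_inv_rev, inv_inv]

end IsInvertingPair

namespace IsInvertedGenerators

variable {P : Type*} [Group P] {α : MulAut P} {x y : P}

theorem symm (h : IsInvertedGenerators α x y) : IsInvertedGenerators α y x :=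
  ⟨Set.pair_comm _ _ ▸ h.closure_eq_top, h.apply_right, h.apply_left⟩

theorem inv_left (h : IsInvertedGenerators α x y) : IsInvertedGenerators α x⁻¹ y := by
  refine ⟨?_, by rw [map_inv, h.apply_left], h.apply_right⟩
  rw [eq_top_iff, ← h.closure_eq_top, Subgroup.closure_le]
  rintro g (rfl | rfl)
  · rw [← inv_inv g]
    exact inv_mem (Subgroup.subset_closure (by simp))
  · exact Subgroup.subset_closure (by simp)

/-- The palindrome `y ^ n * x * y ^ n` is again inverted and can replace `x`. -/
theorem palindrome (h : IsInvertedGenerators α x y) (n : ℤ) :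
    IsInvertedGenerators α (y ^ n * x * y ^ n) y := by
  refine ⟨?_, by simp [h.apply_left, h.apply_right, mul_assoc], h.apply_right⟩
  rw [eq_top_iff, ← h.closure_eq_top, Subgroup.closure_le]
  have hy : y ∈ Subgroup.closure {y ^ n * x * y ^ n, y} := Subgroup.subset_closure (by simp)
  rintro g (rfl | rfl)
  · have h1 : y ^ n * g * y ^ n ∈ Subgroup.closure {y ^ n * g * y ^ n, y} :=
      Subgroup.subset_closure (by simp)
    have := mul_mem (mul_mem (zpow_mem hy (-n)) h1) (zpow_mem hy (-n))
    simpa [mul_assoc] using this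
  · exact hy

variable [Finite P]

theorem left_notMem_frattini (h : IsInvertedGenerators α x y) (hα : IsInvertingPair α) :
    x ∉ frattini P :=
  fun hx => closure_pair_ne_top_of_mem_frattini hα.not_isCyclic hx h.closure_eq_top

theorem cube_mem_center (h : IsInvertedGenerators α x y) (hα : IsInvertingPair α) :
    x ^ 3 ∈ Subgroup.center P := by
  have hp : Fact (Nat.Prime 3) := ⟨Nat.prime_three⟩
  exact hα.mem_center_of_mem_frattini h (hα.isPGroup.pow_mem_frattini x)
    (by rw [map_pow, h.apply_left, inv_pow])

/-- The commutator `d` of the generators is fixed by `α` up to central factors. So is `[d, x]`,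
which `α` also maps to a conjugate of its inverse; in a `3`-group this makes it central. -/
theorem gcomm_gcomm_mem_center (h : IsInvertedGenerators α x y) (hα : IsInvertingPair α) :
    gcomm (gcomm y x) x ∈ Subgroup.center P ∧
      α (gcomm (gcomm y x) x) = (gcomm (gcomm y x) x)⁻¹ := by
  have hp : Fact (Nat.Prime 3) := ⟨Nat.prime_three⟩
  set d := gcomm y x with hd
  set e := gcomm d x with he
  obtain ⟨z, hz, hdz⟩ := hα.apply_eq_mul_center h (hα.isPGroup.gcomm_mem_frattini y x)
  obtain ⟨z', hz', hez⟩ := hα.apply_eq_mul_center h (hα.isPGroup.gcomm_mem_frattini d x)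
  rw [← hd] at hdz
  rw [← he] at hez
  have hαe : α e = x * e⁻¹ * x⁻¹ := by
    have h1 : α e = gcomm (α d) (α x) := map_gcomm α.toMonoidHom d x
    have hzc := Commute.of_mem_center hz
    rw [h1, hdz, h.apply_left, he]
    simp only [gcomm, mul_inv_rev, inv_inv]
    have h2 : z⁻¹ * x * (z * d) = x * d := by
      rw [← mul_assoc, mul_assoc z⁻¹, ← (hzc x).eq, inv_mul_cancel_left]
    rw [mul_assoc d⁻¹, mul_assoc d⁻¹, h2]
    group
  suffices hec : e ∈ Subgroup.center P by
    refine ⟨hec, ?_⟩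
    rw [hαe, ← ((Commute.of_mem_center hec x).inv_left).eq, mul_inv_cancel_right]
  -- Modulo the center, `x` conjugates `e` to its inverse.
  let Z := Subgroup.center P
  have hq : (x : P ⧸ Z) * (e : P ⧸ Z)⁻¹ * (x : P ⧸ Z)⁻¹ = e := by
    rw [← QuotientGroup.mk_inv, ← QuotientGroup.mk_inv, ← QuotientGroup.mk_mul,
      ← QuotientGroup.mk_mul, ← hαe, hez, QuotientGroup.mk_mul,
      (QuotientGroup.eq_one_iff z').mpr hz', one_mul]
  have hx3 : (x : P ⧸ Z) ^ 3 = 1 :=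
    (QuotientGroup.eq_one_iff (x ^ 3)).mpr (h.cube_mem_center hα)
  rw [← QuotientGroup.eq_one_iff]
  refine (hα.isPGroup.to_quotient Z).eq_one_of_zpow_eq_one (n := 2) (by norm_num) ?_
  rw [zpow_ofNat]
  exact sq_eq_one_of_conj_inv_eq hx3 hq

end IsInvertedGenerators

/-! ### Commutator and cube identities -/

section Commutators

variable {G : Type*} [Group G] {x y d e f : G}

theorem mul_eq_mul_mul_gcomm (x y : G) : y * x = x * y * gcomm y x := by
  simp [gcomm, mul_assoc]

theorem inv_gcomm (x y : G) : (gcomm x y)⁻¹ = gcomm y x := by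
  simp [gcomm, mul_assoc]

theorem gcomm_eq_iff : gcomm y x = d ↔ y * x = x * y * d := by
  rw [mul_eq_mul_mul_gcomm x y, mul_right_inj]

/-- Expansion of a cube when `f = [y, x]` commutes with `x` and `y`. -/
theorem cube_mul (h : y * x = x * y * f) (hx : Commute f x) (hy : Commute f y) :
    (x * y) ^ 3 = x ^ 3 * y ^ 3 * f ^ 3 := by
  have h' (g : G) : y * (x * g) = x * (y * (f * g)) := by
    rw [← mul_assoc, h]; simp only [mul_assoc]
  simp only [pow_succ, pow_zero, one_mul, mul_assoc, h', hx.left_comm, hy.eq, hy.left_comm]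

/-- Expansion of a cube, with `d = [y, x]` and `e = [d, x]`. -/
theorem cube_mul_zpow (hd : y * x = x * y * d) (he : d * x = x * d * e) (hdy : Commute d y)
    (hd3 : d ^ 3 = 1) (hey : Commute e y) (hed : Commute e d) (n : ℤ) :
    (x * y ^ n) ^ 3 = x ^ 3 * y ^ (3 * n) * e ^ n := by
  have h1 : y ^ n * x = x * (y ^ n * d ^ n) := by
    rw [← hdy.symm.mul_zpow]
    have h : SemiconjBy x (y * d) y := by rw [SemiconjBy, ← mul_assoc, hd]
    exact (h.zpow_right n).symm
  have h2 : d ^ n * x = x * (d ^ n * e ^ n) := by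
    rw [← hed.symm.mul_zpow]
    have h : SemiconjBy x (d * e) d := by rw [SemiconjBy, ← mul_assoc, he]
    exact (h.zpow_right n).symm
  have hD : (d ^ n) ^ 3 = 1 := by
    rw [← zpow_natCast, ← zpow_mul, mul_comm, zpow_mul, zpow_natCast, hd3, one_zpow]
  have h3 : y ^ (3 * n) = (y ^ n) ^ 3 := by
    rw [mul_comm, zpow_mul, zpow_ofNat]
  have c1 : Commute (d ^ n) (y ^ n) := hdy.zpow_zpow n n
  have c2 : Commute (e ^ n) (y ^ n) := hey.zpow_zpow n n
  have c3 : Commute (e ^ n) (d ^ n) := hed.zpow_zpow n n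
  rw [h3]
  generalize y ^ n = Y at *
  generalize d ^ n = D at *
  generalize e ^ n = E at *
  have h1' (g : G) : Y * (x * g) = x * (Y * (D * g)) := by
    rw [← mul_assoc, h1]; simp only [mul_assoc]
  have h2' (g : G) : D * (x * g) = x * (D * (E * g)) := by
    rw [← mul_assoc, h2]; simp only [mul_assoc]
  have h4 : (x * Y) ^ 3 = x ^ 3 * Y ^ 3 * D ^ 3 * E := by
    simp only [pow_succ, pow_zero, one_mul, mul_assoc, h1', h2', c1.eq, c1.left_comm, c2.eq]
  rw [h4, hD, mul_one]

theorem gcomm_inv_left_of_mem_center (h : gcomm x⁻¹ y ∈ Subgroup.center G) :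
    gcomm x y = (gcomm x⁻¹ y)⁻¹ := by
  have h1 : gcomm x y = x⁻¹ * (gcomm x⁻¹ y)⁻¹ * x := by simp [gcomm, mul_assoc]
  rw [h1, ← (Commute.of_mem_center (inv_mem h) x⁻¹).eq, inv_mul_cancel_right]

/-- If `x ^ 3` and `y ^ 3` are central, then conjugating `y` by `x` and `x` by `y` does not change
their cubes. When `[d, x]` and `[d, y]` are central, this kills the cubes of `d`, `[d, x]` and
`[d, y]`. -/
theorem cube_gcomm_eq_one (hx : x ^ 3 ∈ Subgroup.center G) (hy : y ^ 3 ∈ Subgroup.center G)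
    (he : gcomm (gcomm y x) x ∈ Subgroup.center G) (hf : gcomm (gcomm y x) y ∈ Subgroup.center G) :
    gcomm y x ^ 3 = 1 ∧ gcomm (gcomm y x) x ^ 3 = 1 ∧ gcomm (gcomm y x) y ^ 3 = 1 := by
  have h0 := mul_eq_mul_mul_gcomm x y
  have h1 := mul_eq_mul_mul_gcomm x (gcomm y x)
  have h2 := mul_eq_mul_mul_gcomm y (gcomm y x)
  generalize hd : gcomm y x = d at *
  generalize gcomm d x = e at *
  generalize gcomm d y = f at *
  have he := Commute.of_mem_center he
  have hf' := Commute.of_mem_center hf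
  have hA : d ^ 3 * f ^ 3 = 1 := by
    have h3 := cube_mul h2 (hf' y) (hf' d)
    have h4 : SemiconjBy x (y * d) y := by rw [SemiconjBy, ← mul_assoc, h0]
    have h5 : x * (y * d) ^ 3 = y ^ 3 * x := h4.pow_right 3
    rw [(Commute.of_mem_center hy x).eq, mul_right_inj] at h5
    rw [h5, mul_assoc] at h3
    exact (mul_eq_left.mp h3.symm)
  have hB : (d⁻¹) ^ 3 * (e⁻¹) ^ 3 = 1 := by
    have h1' : d⁻¹ * x = x * d⁻¹ * e⁻¹ := by
      rw [inv_mul_eq_iff_eq_mul, ← mul_assoc, ← mul_assoc, h1, mul_assoc x,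
        ← (he d).eq]
      simp only [mul_assoc, mul_inv_cancel, mul_one]
    have h3 := cube_mul h1' ((he x).inv_left) ((he d⁻¹).inv_left)
    have h4 : SemiconjBy y (x * d⁻¹) x := by
      rw [SemiconjBy, ← mul_assoc, h0, mul_inv_cancel_right]
    have h5 : y * (x * d⁻¹) ^ 3 = x ^ 3 * y := h4.pow_right 3
    rw [(Commute.of_mem_center hx y).eq, mul_right_inj] at h5
    rw [h5, mul_assoc] at h3
    exact (mul_eq_left.mp h3.symm)
  have hdc : Commute (d ^ 3) x := by
    rw [eq_inv_of_mul_eq_one_left hA]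
    exact ((hf' x).pow_left 3).inv_left
  have he3 : e ^ 3 = 1 := by
    have h4 : SemiconjBy x (d * e) d := by rw [SemiconjBy, ← mul_assoc, h1]
    have h5 : x * (d * e) ^ 3 = d ^ 3 * x := h4.pow_right 3
    rw [hdc.eq, mul_right_inj, (he d).symm.mul_pow] at h5
    exact mul_eq_left.mp h5
  have hd3 : d ^ 3 = 1 := by
    rwa [inv_pow e, he3, inv_one, mul_one, inv_pow, inv_eq_one] at hB
  refine ⟨hd3, he3, ?_⟩
  rwa [hd3, one_mul] at hA

end Commutators

/-! ### Normalization of the generators -/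

/-- Inverted generators `x`, `y` for which `y` commutes with the commutator `[y, x]`. -/
structure IsNormalizedGenerators {P : Type*} [Group P] (α : MulAut P) (x y : P) : Prop
    extends IsInvertedGenerators α x y where
  commute : Commute (gcomm y x) y

/-- Two elements of order dividing three in a cyclic `3`-group: the second is a power of the first
unless the first is trivial. -/
theorem IsPGroup.exists_zpow_eq_of_cube_eq_one {G : Type*} [Group G] (hG : IsPGroup 3 G)
    {e f g : G} (he : e ∈ Subgroup.zpowers g) (hf : f ∈ Subgroup.zpowers g) (he3 : e ^ 3 = 1)
    (hf3 : f ^ 3 = 1) (he1 : e ≠ 1) : ∃ n : ℤ, f = e ^ n := by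
  have hp : Fact (Nat.Prime 3) := ⟨Nat.prime_three⟩
  obtain ⟨k, hk⟩ := IsPGroup.iff_orderOf.mp hG g
  obtain ⟨a, rfl⟩ := he
  obtain ⟨b, rfl⟩ := hf
  dsimp only at *
  have key {c : ℤ} (hc : (g ^ c) ^ 3 = 1) : (3 : ℤ) ^ k ∣ c * 3 := by
    rw [← zpow_natCast, ← zpow_mul, ← orderOf_dvd_iff_zpow_eq_one, hk] at hc
    exact mod_cast hc
  rcases k with _ | k
  · rw [pow_zero, orderOf_eq_one_iff] at hk
    exact absurd (by rw [hk, one_zpow]) he1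
  obtain ⟨a', rfl⟩ : (3 : ℤ) ^ k ∣ a :=
    Int.dvd_of_mul_dvd_mul_right (by norm_num) (pow_succ (3 : ℤ) k ▸ key he3)
  obtain ⟨b', rfl⟩ : (3 : ℤ) ^ k ∣ b :=
    Int.dvd_of_mul_dvd_mul_right (by norm_num) (pow_succ (3 : ℤ) k ▸ key hf3)
  have ha' : ¬ ((3 : ℕ) : ℤ) ∣ a' := by
    rintro ⟨c, rfl⟩
    apply he1
    rw [← orderOf_dvd_iff_zpow_eq_one, hk]
    exact ⟨c, by push_cast; ring⟩
  have h1 := Subgroup.zpow_mem _ (hG.mem_zpowers_zpow (g ^ (3 : ℤ) ^ k) ha') b'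
  rw [← zpow_mul, ← zpow_mul] at h1
  obtain ⟨n, hn⟩ := h1
  exact ⟨n, hn.symm⟩

namespace IsInvertedGenerators

variable {P : Type*} [Group P] [Finite P] {α : MulAut P} {x y : P}

theorem gcomm_gcomm_right_mem_center (h : IsInvertedGenerators α x y) (hα : IsInvertingPair α) :
    gcomm (gcomm y x) y ∈ Subgroup.center P ∧
      α (gcomm (gcomm y x) y) = (gcomm (gcomm y x) y)⁻¹ := by
  obtain ⟨h1, h2⟩ := h.symm.gcomm_gcomm_mem_center hα
  rw [← inv_gcomm y x] at h1 h2
  rw [gcomm_inv_left_of_mem_center h1]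
  exact ⟨inv_mem h1, by rw [map_inv, h2]⟩

theorem cube_gcomm (h : IsInvertedGenerators α x y) (hα : IsInvertingPair α) :
    gcomm y x ^ 3 = 1 ∧ gcomm (gcomm y x) x ^ 3 = 1 ∧ gcomm (gcomm y x) y ^ 3 = 1 :=
  cube_gcomm_eq_one (h.cube_mem_center hα) (h.symm.cube_mem_center hα)
    (h.gcomm_gcomm_mem_center hα).1 (h.gcomm_gcomm_right_mem_center hα).1

theorem exists_isNormalizedGenerators (h : IsInvertedGenerators α x y) (hα : IsInvertingPair α) :
    ∃ x y, IsNormalizedGenerators α x y := by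
  have hp : Fact (Nat.Prime 3) := ⟨Nat.prime_three⟩
  obtain ⟨-, he3, hf3⟩ := h.cube_gcomm hα
  obtain ⟨hec, hαe⟩ := h.gcomm_gcomm_mem_center hα
  obtain ⟨hfc, hαf⟩ := h.gcomm_gcomm_right_mem_center hα
  by_cases he : gcomm (gcomm y x) x = 1
  · refine ⟨y, x, h.symm, ?_⟩
    rw [← inv_gcomm]
    exact (gcomm_eq_one_iff_commute.mp he).inv_left
  obtain ⟨g, heg, hfg⟩ := (hα.dichotomy _ _ hαe hαf).resolve_left
    (closure_pair_ne_top_of_mem_frattini hα.not_isCyclic (hα.isPGroup.gcomm_mem_frattini _ _))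
  obtain ⟨n, hn⟩ := hα.isPGroup.exists_zpow_eq_of_cube_eq_one heg hfg he3 hf3 he
  -- With `e = [d, x]` and `[d, y] = e ^ n`, the element `x ^ n * y * x ^ n` commutes with `d`
  -- because `e ^ (n + n + n) = 1`.
  refine ⟨x, x ^ n * y * x ^ n, (h.symm.palindrome n).symm, ?_⟩
  have h0 := mul_eq_mul_mul_gcomm x y
  have h1 := mul_eq_mul_mul_gcomm x (gcomm y x)
  have h2 := mul_eq_mul_mul_gcomm y (gcomm y x)
  rw [hn] at h2
  generalize gcomm y x = d at *
  generalize gcomm d x = e at *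
  have hE := Commute.of_mem_center (zpow_mem hec n)
  have h1n : d * x ^ n = x ^ n * (d * e ^ n) := by
    have h3 : SemiconjBy d x (x * e) := by
      rw [SemiconjBy, h1, mul_assoc, mul_assoc, (Commute.of_mem_center hec d).eq]
    have h4 : d * x ^ n = (x * e) ^ n * d := h3.zpow_right n
    rw [h4, (Commute.of_mem_center hec x).symm.mul_zpow, mul_assoc, (hE d).eq]
  have hE3 : e ^ n * (e ^ n * e ^ n) = 1 := by
    rw [← zpow_add, ← zpow_add, show n + (n + n) = (3 : ℕ) * n by push_cast; ring, zpow_mul,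
      zpow_natCast, he3, one_zpow]
  have hX : Commute (x ^ n) x := (Commute.refl x).zpow_left n
  generalize x ^ n = X at *
  generalize e ^ n = E at *
  have hdd : gcomm (X * y * X) x = d * E := by
    rw [gcomm_eq_iff]
    calc X * y * X * x = X * (y * x) * X := by rw [mul_assoc _ X, hX.eq]; simp only [mul_assoc]
      _ = X * x * y * (d * X) := by rw [h0]; simp only [mul_assoc]
      _ = x * (X * y * X) * (d * E) := by rw [h1n, hX.eq]; simp only [mul_assoc]
  rw [hdd]
  refine Commute.mul_left ?_ (hE _)
  calc d * (X * y * X) = X * d * (E * (y * X)) := by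
        rw [← mul_assoc, ← mul_assoc, h1n]; simp only [mul_assoc]
    _ = X * (d * y) * X * E := by rw [(hE _).eq]; simp only [mul_assoc]
    _ = X * y * d * (E * X) * E := by rw [h2]; simp only [mul_assoc]
    _ = X * y * (d * X) * E * E := by rw [(hE _).eq]; simp only [mul_assoc]
    _ = X * y * X * d * (E * (E * E)) := by rw [h1n]; simp only [mul_assoc]
    _ = X * y * X * d := by rw [hE3, mul_one]

end IsInvertedGenerators

namespace IsNormalizedGenerators

variable {P : Type*} [Group P] {α : MulAut P} {x y : P}

theorem gcomm_palindrome (h : IsNormalizedGenerators α x y) (n : ℤ) :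
    gcomm y (y ^ n * x * y ^ n) = gcomm y x := by
  have hd := h.commute.zpow_right n
  have hy := (Commute.refl y).zpow_right n
  have h0 := mul_eq_mul_mul_gcomm x y
  rw [gcomm_eq_iff]
  generalize y ^ n = Y at *
  calc y * (Y * x * Y) = y * Y * x * Y := by simp only [mul_assoc]
    _ = Y * (y * x) * Y := by rw [hy.eq]; simp only [mul_assoc]
    _ = Y * x * y * (gcomm y x * Y) := by rw [h0]; simp only [mul_assoc]
    _ = Y * x * (y * Y) * gcomm y x := by rw [hd.eq]; simp only [mul_assoc]
    _ = Y * x * Y * y * gcomm y x := by rw [hy.eq]; simp only [mul_assoc]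

theorem palindrome (h : IsNormalizedGenerators α x y) (n : ℤ) :
    IsNormalizedGenerators α (y ^ n * x * y ^ n) y :=
  ⟨h.toIsInvertedGenerators.palindrome n, by rw [h.gcomm_palindrome]; exact h.commute⟩

variable [Finite P]

theorem gcomm_gcomm_palindrome (h : IsNormalizedGenerators α x y) (hα : IsInvertingPair α) (n : ℤ) :
    gcomm (gcomm y (y ^ n * x * y ^ n)) (y ^ n * x * y ^ n) = gcomm (gcomm y x) x := by
  rw [h.gcomm_palindrome]
  have hd := h.commute.zpow_right n
  have he := Commute.of_mem_center (h.gcomm_gcomm_mem_center hα).1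
  have h1 := mul_eq_mul_mul_gcomm x (gcomm y x)
  rw [gcomm_eq_iff]
  calc gcomm y x * (y ^ n * x * y ^ n) = gcomm y x * y ^ n * (x * y ^ n) := by
        simp only [mul_assoc]
    _ = y ^ n * (gcomm y x * x) * y ^ n := by rw [hd.eq]; simp only [mul_assoc]
    _ = y ^ n * x * (gcomm y x * (gcomm (gcomm y x) x * y ^ n)) := by
      rw [h1]; simp only [mul_assoc]
    _ = y ^ n * x * (gcomm y x * y ^ n * gcomm (gcomm y x) x) := by
      rw [(he (y ^ n)).eq]; simp only [mul_assoc]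
    _ = _ := by rw [hd.eq]; simp only [mul_assoc]

theorem inv_left (h : IsNormalizedGenerators α x y) (hα : IsInvertingPair α) :
    IsNormalizedGenerators α x⁻¹ y ∧
      gcomm (gcomm y x⁻¹) x⁻¹ = gcomm (gcomm y x) x := by
  have he := Commute.of_mem_center (h.gcomm_gcomm_mem_center hα).1
  have h0 := mul_eq_mul_mul_gcomm x y
  have h1 := mul_eq_mul_mul_gcomm x (gcomm y x)
  have hd := h.commute
  have hinv := h.toIsInvertedGenerators.inv_left
  generalize hdd : gcomm y x = d at *
  generalize gcomm d x = e at *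
  have h2 : x * d⁻¹ = d⁻¹ * e * x := by
    rw [mul_inv_eq_iff_eq_mul, mul_assoc, mul_assoc, eq_inv_mul_iff_mul_eq, h1, ← (he _).eq,
      ← mul_assoc]
  have h3 : gcomm y x⁻¹ = d⁻¹ * e := by
    rw [gcomm_eq_iff, mul_inv_eq_iff_eq_mul, mul_assoc, ← h2, mul_assoc, eq_inv_mul_iff_mul_eq,
      ← mul_assoc, h0, mul_inv_cancel_right]
  refine ⟨⟨hinv, ?_⟩, ?_⟩
  · rw [h3]
    exact hd.inv_left.mul_left (he y)
  · rw [h3, gcomm_eq_iff, mul_inv_eq_iff_eq_mul, mul_assoc, mul_assoc, eq_inv_mul_iff_mul_eq,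
      ← mul_assoc, ← mul_assoc, h2]
    simp only [mul_assoc, (he x).eq, (he x).left_comm]

theorem cube_palindrome (h : IsNormalizedGenerators α x y) (hα : IsInvertingPair α) (n : ℤ) :
    (y ^ n * x * y ^ n) ^ 3 = x ^ 3 * (y ^ 3) ^ (2 * n) * gcomm (gcomm y x) x ^ (2 * n) := by
  have hec := (h.gcomm_gcomm_mem_center hα).1
  have he := Commute.of_mem_center hec
  have h1 := cube_mul_zpow (mul_eq_mul_mul_gcomm x y) (mul_eq_mul_mul_gcomm x (gcomm y x))
    h.commute (h.cube_gcomm hα).1 (he _) (he _) (2 * n)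
  have h2 : SemiconjBy (y ^ n) (x * y ^ (2 * n)) (y ^ n * x * y ^ n) := by
    rw [SemiconjBy, two_mul, zpow_add]
    simp only [mul_assoc]
  have h3 : y ^ (3 * (2 * n)) = (y ^ 3) ^ (2 * n) := by
    rw [zpow_mul, zpow_ofNat]
  have h4 : y ^ n * (x * y ^ (2 * n)) ^ 3 = (y ^ n * x * y ^ n) ^ 3 * y ^ n := h2.pow_right 3
  have hc : (x * y ^ (2 * n)) ^ 3 ∈ Subgroup.center P := by
    rw [h1, h3]
    exact mul_mem (mul_mem (h.cube_mem_center hα) (zpow_mem (h.symm.cube_mem_center hα) _))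
      (zpow_mem hec _)
  rw [← (Commute.of_mem_center hc _).eq, mul_left_inj] at h4
  rw [← h4, h1, h3]

/-- As `x ^ 3` is a power of `y ^ 3`, the factor coming from the cubes of the generators can be
removed by passing to a suitable palindrome. -/
theorem exists_cube_palindrome (h : IsNormalizedGenerators α x y) (hα : IsInvertingPair α) :
    ∃ n : ℤ, (y ^ n * x * y ^ n) ^ 3 = gcomm (gcomm y x) x ^ (2 * n) := by
  have hp : Fact (Nat.Prime 3) := ⟨Nat.prime_three⟩
  have hx3 := hα.mem_zpowers_cube (hα.isPGroup.pow_mem_frattini x)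
    (by rw [map_pow, h.apply_left, inv_pow]) (h.symm.left_notMem_frattini hα) h.apply_right
  obtain ⟨m, hm⟩ := hx3
  obtain ⟨j, hj⟩ := hα.isPGroup.mem_zpowers_zpow (y ^ 3) (n := 2) (by norm_num)
  dsimp only at hm hj
  refine ⟨-(j * m), ?_⟩
  rw [h.cube_palindrome hα, mul_eq_right, ← hm]
  have h1 : (y ^ 3) ^ (2 * -(j * m)) = ((((y ^ 3) ^ (2 : ℤ)) ^ j) ^ m)⁻¹ := by
    rw [← zpow_mul, ← zpow_mul, ← zpow_neg]
    congr 1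
    ring
  rw [h1, hj, mul_inv_cancel]

/-- When `[y, x]` is central, some pair of generators has trivial cubes. -/
theorem exists_cube_eq_one (h : IsNormalizedGenerators α x y) (hα : IsInvertingPair α)
    (he : gcomm (gcomm y x) x = 1) : ∃ u v, Subgroup.closure {u, v} = ⊤ ∧ u ^ 3 = 1 ∧ v ^ 3 = 1 ∧
      gcomm v u ^ 3 = 1 ∧ gcomm v u ∈ Subgroup.center P := by
  have hp : Fact (Nat.Prime 3) := ⟨Nat.prime_three⟩
  obtain ⟨n, hn⟩ := h.exists_cube_palindrome hα
  rw [he, one_zpow] at hn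
  have hu := h.palindrome n
  have hy := hα.mem_zpowers_cube (hα.isPGroup.pow_mem_frattini y)
    (by rw [map_pow, h.apply_right, inv_pow]) (hu.left_notMem_frattini hα) hu.apply_left
  rw [hn, Subgroup.zpowers_one_eq_bot, Subgroup.mem_bot] at hy
  refine ⟨_, y, hu.closure_eq_top, hn, hy, (hu.cube_gcomm hα).1, ?_⟩
  rw [h.gcomm_palindrome]
  exact Subgroup.mem_center_of_closure_pair h.closure_eq_top (gcomm_eq_one_iff_commute.mp he)
    h.commute

/-- If `x ^ 3 = e ^ ε` and `y ^ 3 = e ^ δ`, then the palindromes have cubes `e ^ (ε + 2 n (δ + 1))`.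
That none of these is trivial forces `δ = 2` and `ε ≠ 0` modulo three. -/
theorem cube_eq_sq (h : IsNormalizedGenerators α x y) (hα : IsInvertingPair α)
    (he : gcomm (gcomm y x) x ≠ 1) {ε : ℤ} (hx : x ^ 3 = gcomm (gcomm y x) x ^ ε) :
    y ^ 3 = gcomm (gcomm y x) x ^ 2 ∧
      (x ^ 3 = gcomm (gcomm y x) x ∨ x ^ 3 = gcomm (gcomm y x) x ^ 2) := by
  have hp : Fact (Nat.Prime 3) := ⟨Nat.prime_three⟩
  obtain ⟨hec, hαe⟩ := h.gcomm_gcomm_mem_center hα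
  have heΦ := hα.isPGroup.gcomm_mem_frattini (gcomm y x) x
  have hy3 := hα.mem_zpowers_cube (hα.isPGroup.pow_mem_frattini y)
    (by rw [map_pow, h.apply_right, inv_pow]) (h.left_notMem_frattini hα) h.apply_left
  have he3 := (h.cube_gcomm hα).2.1
  -- No palindrome can have trivial cube, since its cube generates a subgroup containing `e`.
  have key (n : ℤ) : (y ^ n * x * y ^ n) ^ 3 ≠ 1 := by
    intro h1
    have hu := h.palindrome n
    have h2 := hα.mem_zpowers_cube heΦ hαe (hu.left_notMem_frattini hα) hu.apply_left
    rw [h1, Subgroup.zpowers_one_eq_bot, Subgroup.mem_bot] at h2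
    exact he h2
  obtain ⟨δ', hδ⟩ := hy3
  dsimp only at hδ
  have hcp (n : ℤ) := h.cube_palindrome hα n
  generalize gcomm (gcomm y x) x = e at *
  rw [hx, ← zpow_mul] at hδ
  generalize ε * δ' = δ at *
  have hcong {a b : ℤ} (hab : (3 : ℤ) ∣ a - b) : e ^ a = e ^ b := by
    obtain ⟨c, hc⟩ := hab
    rw [show a = (3 : ℕ) * c + b by push_cast; omega, zpow_add, zpow_mul, zpow_natCast, he3,
      one_zpow, one_mul]
  have hne (n : ℤ) : ¬ (3 : ℤ) ∣ ε + δ * (2 * n) + 2 * n := by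
    intro hdvd
    apply key n
    rw [hcp, hx, ← hδ, ← zpow_mul, ← zpow_add, ← zpow_add, ← zpow_zero e]
    exact hcong (by rwa [sub_zero])
  have h0 := hne 0
  have h1 := hne 1
  have h2 := hne (-1)
  constructor
  · rw [← hδ, ← zpow_natCast]
    refine hcong ?_
    have hε : ε % 3 = 0 ∨ ε % 3 = 1 ∨ ε % 3 = 2 := by omega
    have hδ : δ % 3 = 0 ∨ δ % 3 = 1 ∨ δ % 3 = 2 := by omega
    rcases hε with hε | hε | hε <;> rcases hδ with hδ | hδ | hδ <;> push_cast <;> omega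
  · have hε : ε % 3 = 0 ∨ ε % 3 = 1 ∨ ε % 3 = 2 := by omega
    have : (3 : ℤ) ∣ ε - 1 ∨ (3 : ℤ) ∣ ε - (2 : ℕ) := by push_cast; omega
    rw [hx]
    refine this.imp (fun h => ?_) (fun h => ?_)
    · rw [hcong h, zpow_one]
    · rw [hcong h, zpow_natCast]

/-- When `e = [[y, x], x]` is non-trivial, some normalized generators satisfy the relations
`x ^ 3 = y ^ 3 = e ^ 2`. -/
theorem exists_cube_eq_sq (h : IsNormalizedGenerators α x y) (hα : IsInvertingPair α)
    (he : gcomm (gcomm y x) x ≠ 1) : ∃ u v, IsNormalizedGenerators α u v ∧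
      gcomm (gcomm v u) u ≠ 1 ∧ u ^ 3 = gcomm (gcomm v u) u ^ 2 ∧
      v ^ 3 = gcomm (gcomm v u) u ^ 2 := by
  obtain ⟨n, hn⟩ := h.exists_cube_palindrome hα
  have hu := h.palindrome n
  rw [← h.gcomm_gcomm_palindrome hα n] at he hn
  generalize y ^ n * x * y ^ n = u at *
  obtain ⟨hy, hu3 | hu3⟩ := hu.cube_eq_sq hα he hn
  · obtain ⟨hi, hie⟩ := hu.inv_left hα
    refine ⟨u⁻¹, y, hi, ?_, ?_, ?_⟩ <;> rw [hie]
    · exact he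
    · rw [inv_pow, hu3, inv_eq_iff_mul_eq_one, ← pow_succ', (hu.cube_gcomm hα).2.1]
    · exact hy
  · exact ⟨u, y, hu, he, hu3, hy⟩

end IsNormalizedGenerators

/-! ### Normal forms and groups of class two -/

section NormalForm

variable {G : Type*} [Group G] {x y d e : G}

/-- A group of class at most three generated by `x` and `y`, where `[d, y] = 1` for `d = [y, x]`,
consists of the elements `x ^ i * y ^ j * d ^ k * e ^ l` with `e = [d, x]`. -/
theorem exists_eq_zpow_mul_zpow (hxy : Subgroup.closure {x, y} = ⊤) (hd : y * x = x * y * d)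
    (he : d * x = x * d * e) (hdy : Commute d y) (hec : e ∈ Subgroup.center G) (g : G) :
    ∃ i j k l : ℤ, g = x ^ i * y ^ j * d ^ k * e ^ l := by
  have hE := Commute.of_mem_center hec
  have hx' : x * d⁻¹ = d⁻¹ * e * x := by
    rw [mul_inv_eq_iff_eq_mul, mul_assoc, mul_assoc, eq_inv_mul_iff_mul_eq, he, ← (hE _).eq,
      ← mul_assoc]
  -- Right multiplication by `x ^ s`, where `s = 1` or `s = -1`.
  have step (s b : ℤ) (h1 : SemiconjBy (x ^ s) (y * (d ^ s * e ^ b)) y)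
      (h2 : SemiconjBy (x ^ s) (d * e ^ s) d) (i j k l : ℤ) :
      x ^ i * y ^ j * d ^ k * e ^ l * x ^ s =
        x ^ (i + s) * y ^ j * d ^ (s * j + k) * e ^ (b * j + s * k + l) := by
    have c1 : Commute y (d ^ s * e ^ b) :=
      (hdy.symm.zpow_right s).mul_right ((hE y).symm.zpow_right b)
    have c2 : Commute (d ^ s) (e ^ b) := ((hE d).symm.zpow_zpow s b)
    have h3 : x ^ s * (y ^ j * (d ^ (s * j) * e ^ (b * j))) = y ^ j * x ^ s := by
      have := h1.zpow_right j
      rwa [c1.mul_zpow, c2.mul_zpow, ← zpow_mul, ← zpow_mul] at this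
    have h4 : x ^ s * (d ^ k * e ^ (s * k)) = d ^ k * x ^ s := by
      have := h2.zpow_right k
      rwa [((hE d).symm.zpow_right s).mul_zpow, ← zpow_mul] at this
    calc x ^ i * y ^ j * d ^ k * e ^ l * x ^ s = x ^ i * y ^ j * (d ^ k * x ^ s) * e ^ l := by
          rw [mul_assoc _ (e ^ l), ((hE (x ^ s)).zpow_left l).eq]; simp only [mul_assoc]
      _ = x ^ i * (y ^ j * x ^ s) * d ^ k * e ^ (s * k) * e ^ l := by
          rw [← h4]; simp only [mul_assoc]
      _ = x ^ i * x ^ s * y ^ j * d ^ (s * j) * (e ^ (b * j) * d ^ k) * e ^ (s * k) * e ^ l := by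
          rw [← h3]; simp only [mul_assoc]
      _ = (x ^ i * x ^ s) * y ^ j * (d ^ (s * j) * d ^ k) *
            (e ^ (b * j) * e ^ (s * k) * e ^ l) := by
          rw [((hE d).zpow_zpow (b * j) k).eq]; simp only [mul_assoc]
      _ = _ := by simp only [zpow_add]
  have hy (s i j k l : ℤ) : x ^ i * y ^ j * d ^ k * e ^ l * y ^ s =
      x ^ i * y ^ (j + s) * d ^ k * e ^ l := by
    rw [mul_assoc _ (e ^ l), ((hE y).zpow_zpow l s).eq, ← mul_assoc, mul_assoc _ (d ^ k),
      (hdy.zpow_zpow k s).eq, zpow_add]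
    simp only [mul_assoc]
  have hx1 := step 1 0 (by rw [SemiconjBy, zpow_one, zpow_one, zpow_zero, mul_one, ← mul_assoc, hd])
    (by rw [SemiconjBy, zpow_one, zpow_one, ← mul_assoc, he])
  have hx2 := step (-1) 1
    (by
      rw [zpow_neg_one, zpow_neg_one, zpow_one]
      apply SemiconjBy.inv_symm_left
      rw [SemiconjBy, mul_assoc y, ← hx', ← mul_assoc, hd, mul_inv_cancel_right])
    (by
      rw [zpow_neg_one, zpow_neg_one]
      apply SemiconjBy.inv_symm_left
      rw [SemiconjBy, mul_assoc, (hE x).inv_left.eq, ← mul_assoc, he, mul_inv_cancel_right])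
  have hg : g ∈ Subgroup.closure {x, y} := hxy ▸ Subgroup.mem_top g
  induction hg using Subgroup.closure_induction_right with
  | one => exact ⟨0, 0, 0, 0, by simp⟩
  | mul_right g _ t ht ih =>
    obtain ⟨i, j, k, l, rfl⟩ := ih
    rcases ht with rfl | rfl
    · exact ⟨_, _, _, _, by simpa only [zpow_one] using hx1 i j k l⟩
    · exact ⟨_, _, _, _, by simpa only [zpow_one] using hy 1 i j k l⟩
  | mul_inv_cancel g _ t ht ih =>
    obtain ⟨i, j, k, l, rfl⟩ := ih
    rcases ht with rfl | rfl
    · exact ⟨_, _, _, _, by simpa only [zpow_neg_one] using hx2 i j k l⟩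
    · exact ⟨_, _, _, _, by simpa only [zpow_neg_one] using hy (-1) i j k l⟩

end NormalForm

/-- Two generators of a non-cyclic `p`-group are independent modulo the Frattini subgroup. -/
theorem IsPGroup.dvd_of_zpow_mul_zpow_mem_frattini {p : ℕ} [Fact p.Prime] {G : Type*} [Group G]
    [Finite G] (hG : IsPGroup p G) (hc : ¬ IsCyclic G) {x y : G}
    (hxy : Subgroup.closure {x, y} = ⊤) {i j : ℤ} (h : x ^ i * y ^ j ∈ frattini G) :
    (p : ℤ) ∣ i ∧ (p : ℤ) ∣ j := by
  constructor
  · by_contra hi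
    apply closure_pair_ne_top_of_mem_frattini hc h (v := y)
    rw [eq_top_iff, ← hxy, Subgroup.closure_le]
    have hy : y ∈ Subgroup.closure {x ^ i * y ^ j, y} := Subgroup.subset_closure (by simp)
    rintro g (rfl | rfl)
    · have h1 : g ^ i * y ^ j ∈ Subgroup.closure {g ^ i * y ^ j, y} :=
        Subgroup.subset_closure (by simp)
      have h2 := mul_mem h1 (inv_mem (zpow_mem hy j))
      rw [mul_inv_cancel_right] at h2
      exact Subgroup.zpowers_le.mpr h2 (hG.mem_zpowers_zpow g hi)
    · exact hy
  · by_contra hj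
    apply closure_pair_ne_top_of_mem_frattini hc h (v := x)
    rw [eq_top_iff, ← hxy, Subgroup.closure_le]
    have hx : x ∈ Subgroup.closure {x ^ i * y ^ j, x} := Subgroup.subset_closure (by simp)
    rintro g (rfl | rfl)
    · exact hx
    · have h1 : x ^ i * g ^ j ∈ Subgroup.closure {x ^ i * g ^ j, x} :=
        Subgroup.subset_closure (by simp)
      have h2 := mul_mem (inv_mem (zpow_mem hx i)) h1
      rw [inv_mul_cancel_left] at h2
      exact Subgroup.zpowers_le.mpr h2 (hG.mem_zpowers_zpow g hj)

section ClassTwo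

variable {P : Type*} [Group P] {x y : P}

theorem zpow_congr_of_cube_eq_one (h : x ^ 3 = 1) {a b : ℤ} (hab : (3 : ℤ) ∣ a - b) :
    x ^ a = x ^ b := by
  obtain ⟨c, hc⟩ := hab
  rw [show a = (3 : ℕ) * c + b by push_cast; omega, zpow_add, zpow_mul, zpow_natCast, h,
    one_zpow, one_mul]

theorem exists_eq_zpow_mul_of_gcomm_mem_center (hxy : Subgroup.closure {x, y} = ⊤)
    (hd : gcomm y x ∈ Subgroup.center P) (g : P) :
    ∃ i j k : ℤ, g = x ^ i * y ^ j * gcomm y x ^ k := by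
  have hD := Commute.of_mem_center hd
  obtain ⟨i, j, k, l, rfl⟩ := exists_eq_zpow_mul_zpow (e := 1) hxy (mul_eq_mul_mul_gcomm x y)
    (by rw [mul_one, (hD x).eq]) (hD y) (one_mem _) g
  exact ⟨i, j, k, by rw [one_zpow, mul_one]⟩

variable [Finite P]

/-- The elements `x ^ i * y ^ j * z` with `i`, `j` modulo three and `z` a power of `[y, x]` are
pairwise distinct and exhaust the group. -/
theorem IsPGroup.card_eq_nine_mul (hP : IsPGroup 3 P) (hc : ¬ IsCyclic P)
    (hxy : Subgroup.closure {x, y} = ⊤) (hx : x ^ 3 = 1) (hy : y ^ 3 = 1)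
    (hd : gcomm y x ∈ Subgroup.center P) : Nat.card P = 9 * orderOf (gcomm y x) := by
  have hp : Fact (Nat.Prime 3) := ⟨Nat.prime_three⟩
  let F : Fin 3 × Fin 3 × Subgroup.zpowers (gcomm y x) → P :=
    fun t => x ^ ((t.1 : ℕ) : ℤ) * y ^ ((t.2.1 : ℕ) : ℤ) * t.2.2
  have hz (z : Subgroup.zpowers (gcomm y x)) : (z : P) ∈ frattini P :=
    Subgroup.zpowers_le.mpr (hP.gcomm_mem_frattini y x) z.2
  have hF : Function.Bijective F := by
    constructor
    · rintro ⟨i, j, z⟩ ⟨i', j', z'⟩ h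
      dsimp only [F] at h
      have h1 : x ^ ((i : ℤ) - i') * y ^ ((j : ℤ) - j') ∈ frattini P := by
        have h2 := congrArg (QuotientGroup.mk (s := frattini P)) h
        simp only [QuotientGroup.mk_mul, QuotientGroup.mk_zpow,
          (QuotientGroup.eq_one_iff _).mpr (hz _), mul_one] at h2
        rw [← QuotientGroup.eq_one_iff]
        simp only [QuotientGroup.mk_mul, QuotientGroup.mk_zpow]
        rw [sub_eq_neg_add (i : ℤ), zpow_add, zpow_sub, mul_assoc,
          ← mul_assoc ((x : P ⧸ frattini P) ^ (i : ℤ)), h2, zpow_neg]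
        simp only [mul_assoc, mul_inv_cancel, mul_one, inv_mul_cancel]
      obtain ⟨h3, h4⟩ := hP.dvd_of_zpow_mul_zpow_mem_frattini hc hxy h1
      obtain rfl : i = i' := by omega
      obtain rfl : j = j' := by omega
      rw [mul_right_inj] at h
      rw [Subtype.ext h]
    · intro g
      obtain ⟨i, j, k, rfl⟩ := exists_eq_zpow_mul_of_gcomm_mem_center hxy hd g
      have hi (i : ℤ) : ∃ a : Fin 3, (3 : ℤ) ∣ (a : ℕ) - i :=
        ⟨⟨(i % 3).toNat, by omega⟩, by dsimp only; omega⟩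
      obtain ⟨a, ha⟩ := hi i
      obtain ⟨b, hb⟩ := hi j
      refine ⟨⟨a, b, ⟨_, k, rfl⟩⟩, ?_⟩
      dsimp only [F]
      rw [zpow_congr_of_cube_eq_one hx ha, zpow_congr_of_cube_eq_one hy hb]
  rw [← Nat.card_congr (Equiv.ofBijective F hF), Nat.card_prod, Nat.card_prod, Nat.card_zpowers,
    Nat.card_fin, ← mul_assoc, show 3 * 3 = 9 from rfl]

/-- A non-cyclic `3`-group of class at most two with two generators of order three is elementary
abelian of order nine or extraspecial of order `27` and exponent three. -/
theorem IsPGroup.classification_of_gcomm_mem_center (hP : IsPGroup 3 P) (hc : ¬ IsCyclic P)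
    (hxy : Subgroup.closure {x, y} = ⊤) (hx : x ^ 3 = 1) (hy : y ^ 3 = 1)
    (hd3 : gcomm y x ^ 3 = 1) (hd : gcomm y x ∈ Subgroup.center P) :
    (IsElementaryAbelianGroup 3 P ∧ Nat.card P = 9) ∨
    (IsExtraspecialGroup 3 P ∧ Nat.card P = 27 ∧ Monoid.exponent P = 3) := by
  have hp : Fact (Nat.Prime 3) := ⟨Nat.prime_three⟩
  have hcard := hP.card_eq_nine_mul hc hxy hx hy hd
  have hnf := exists_eq_zpow_mul_of_gcomm_mem_center hxy hd
  have hD := Commute.of_mem_center hd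
  have h6 : frattini P ≤ Subgroup.zpowers (gcomm y x) := by
    intro g hg
    obtain ⟨i, j, k, rfl⟩ := hnf g
    have h7 : x ^ i * y ^ j ∈ frattini P := by
      have := mul_mem hg (inv_mem (zpow_mem (hP.gcomm_mem_frattini y x) k))
      rwa [mul_inv_cancel_right] at this
    obtain ⟨hi, hj⟩ := hP.dvd_of_zpow_mul_zpow_mem_frattini hc hxy h7
    rw [zpow_congr_of_cube_eq_one hx (b := 0) (by simpa using hi),
      zpow_congr_of_cube_eq_one hy (b := 0) (by simpa using hj), zpow_zero, zpow_zero, one_mul,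
      one_mul]
    exact zpow_mem (Subgroup.mem_zpowers _) k
  have hexp (g : P) : g ^ 3 = 1 := by
    have hg : g ∈ Subgroup.closure {x, y} := hxy ▸ Subgroup.mem_top g
    induction hg using Subgroup.closure_induction with
    | mem t ht =>
      rcases ht with rfl | rfl
      · exact hx
      · exact hy
    | one => exact one_pow 3
    | inv a _ ha => rw [inv_pow, ha, inv_one]
    | mul a b _ _ ha hb =>
      obtain ⟨n, hn⟩ := h6 (hP.gcomm_mem_frattini b a)
      dsimp only at hn
      rw [cube_mul (mul_eq_mul_mul_gcomm a b) (hn ▸ (hD a).zpow_left n) (hn ▸ (hD b).zpow_left n),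
        ha, hb, ← hn, ← zpow_natCast, zpow_comm, zpow_natCast, hd3, one_zpow, one_mul, one_mul]
  by_cases h1 : gcomm y x = 1
  · left
    have hcen {w : P} (hw : w = x ∨ w = y) : w ∈ Subgroup.center P := by
      have h2 : Commute y x := gcomm_eq_one_iff_commute.mp h1
      rcases hw with rfl | rfl
      · exact Subgroup.mem_center_of_closure_pair hxy rfl h2.symm
      · exact Subgroup.mem_center_of_closure_pair hxy h2 rfl
    refine ⟨⟨fun a b => ?_, hexp⟩, by rw [hcard, h1, orderOf_one]⟩
    have : a ∈ Subgroup.center P := by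
      have h3 : Subgroup.closure {x, y} ≤ Subgroup.center P :=
        (Subgroup.closure_le _).mpr fun w hw => hcen hw
      exact h3 (hxy ▸ Subgroup.mem_top a)
    exact (Commute.of_mem_center this b).eq
  right
  have hord : orderOf (gcomm y x) = 3 := orderOf_eq_prime hd3 h1
  have h3 {n : ℤ} (hn : gcomm y x ^ n = 1) : (3 : ℤ) ∣ n := by
    rwa [← orderOf_dvd_iff_zpow_eq_one, hord] at hn
  have hcenter : Subgroup.center P = Subgroup.zpowers (gcomm y x) := by
    refine le_antisymm (fun g hg => ?_) (Subgroup.zpowers_le.mpr hd)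
    obtain ⟨i, j, k, rfl⟩ := hnf g
    have hw : x ^ i * y ^ j ∈ Subgroup.center P := by
      have := mul_mem hg (inv_mem (zpow_mem hd k))
      rwa [mul_inv_cancel_right] at this
    have hW := Commute.of_mem_center hw
    have hj : (3 : ℤ) ∣ j := by
      apply h3
      have h8 : SemiconjBy x (y * gcomm y x) y := by
        rw [SemiconjBy, ← mul_assoc, ← mul_eq_mul_mul_gcomm]
      have h9 : x * (y * gcomm y x) ^ j = y ^ j * x := h8.zpow_right j
      have h10 : y ^ j * x = x * y ^ j := by
        have := (hW x).eq
        rw [← mul_assoc, ← ((Commute.refl x).zpow_left i).eq, mul_assoc, mul_assoc,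
          mul_right_inj] at this
        exact this
      rwa [h10, mul_right_inj, (hD y).symm.mul_zpow, mul_eq_left] at h9
    have hy1 : y ^ j = 1 := by
      rw [zpow_congr_of_cube_eq_one hy (b := 0) (by simpa using hj), zpow_zero]
    rw [hy1, mul_one] at hW
    have hi : (3 : ℤ) ∣ i := by
      apply h3
      have h8 : SemiconjBy y x (x * gcomm y x) := by
        rw [SemiconjBy, mul_assoc, (hD y).eq, ← mul_assoc]
        exact mul_eq_mul_mul_gcomm x y
      have h9 : y * x ^ i = (x * gcomm y x) ^ i * y := h8.zpow_right i
      rwa [← (hW y).eq, mul_left_inj, (hD x).symm.mul_zpow, left_eq_mul] at h9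
    rw [hy1, zpow_congr_of_cube_eq_one hx (b := 0) (by simpa using hi), zpow_zero, one_mul,
      one_mul]
    exact zpow_mem (Subgroup.mem_zpowers _) k
  have h4 : Subgroup.zpowers (gcomm y x) ≤ commutator P := by
    rw [Subgroup.zpowers_le]
    have : gcomm y x = ⁅y⁻¹, x⁻¹⁆ := by simp [gcomm, commutatorElement_def]
    rw [this]
    exact Subgroup.commutator_mem_commutator (Subgroup.mem_top _) (Subgroup.mem_top _)
  have h5 : commutator P ≤ frattini P := by
    rw [commutator_def, Subgroup.commutator_le]
    intro a _ b _
    have : ⁅a, b⁆ = gcomm a⁻¹ b⁻¹ := by simp [gcomm, commutatorElement_def]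
    rw [this]
    exact hP.gcomm_mem_frattini _ _
  refine ⟨⟨hP, ?_, ?_, ?_⟩, by rw [hcard, hord], ?_⟩
  · rw [hcenter, Nat.card_zpowers, hord]
  · rw [hcenter]
    exact le_antisymm (h5.trans h6) h4
  · rw [hcenter]
    exact le_antisymm h6 (h4.trans h5)
  · refine ((Nat.dvd_prime Nat.prime_three).mp
      (Monoid.exponent_dvd_of_forall_pow_eq_one hexp)).resolve_left fun h => h1 ?_
    have := Monoid.pow_exponent_eq_one (gcomm y x)
    rwa [h, pow_one] at this

end ClassTwo

/-! ### The group of order 81 -/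

/-- Relations saying that `x`, `y`, `d`, `e` satisfy the presentation of `SmallGroup81_10`, with
`x`, `y` in the roles of `b`, `c`. -/
structure SatisfiesSmallGroupRels {G : Type*} [Group G] (x y d e : G) : Prop where
  x_cube : x ^ 3 = e ^ 2
  y_cube : y ^ 3 = e ^ 2
  d_cube : d ^ 3 = 1
  e_cube : e ^ 3 = 1
  gcomm_y_x : gcomm y x = d
  gcomm_d_x : gcomm d x = e
  commute_d_y : Commute d y
  commute_e_x : Commute e x
  commute_e_y : Commute e y
  commute_e_d : Commute e d

namespace SatisfiesSmallGroupRels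

variable {G : Type*} [Group G] {x y d e : G}

theorem lift_eq_one (h : SatisfiesSmallGroupRels x y d e) :
    ∀ r ∈ SmallGroup81x10.rels, FreeGroup.lift ![x, y, d, e] r = 1 := by
  have hb : FreeGroup.lift ![x, y, d, e] SmallGroup81x10.b = x := FreeGroup.lift_apply_of
  have hc : FreeGroup.lift ![x, y, d, e] SmallGroup81x10.c = y := FreeGroup.lift_apply_of
  have hd : FreeGroup.lift ![x, y, d, e] SmallGroup81x10.d = d := FreeGroup.lift_apply_of
  have he : FreeGroup.lift ![x, y, d, e] SmallGroup81x10.e = e := FreeGroup.lift_apply_of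
  rintro r (rfl | rfl | rfl | rfl | rfl | rfl | rfl | rfl | rfl | rfl) <;>
    simp only [map_mul, map_pow, map_inv, map_gcomm, hb, hc, hd, he]
  · rw [h.x_cube, mul_inv_cancel]
  · rw [h.y_cube, mul_inv_cancel]
  · exact h.d_cube
  · exact h.e_cube
  · rw [h.gcomm_y_x, mul_inv_cancel]
  · rw [h.gcomm_d_x, mul_inv_cancel]
  · exact gcomm_eq_one_iff_commute.mpr h.commute_d_y
  · exact gcomm_eq_one_iff_commute.mpr h.commute_e_x
  · exact gcomm_eq_one_iff_commute.mpr h.commute_e_y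
  · exact gcomm_eq_one_iff_commute.mpr h.commute_e_d

/-- A homomorphism from a group given by these relations to a finite non-cyclic `3`-group is
injective as soon as it is onto and does not kill `e`: the exponents of a word in the kernel are
divisible by three, because the images of `x`, `y` are independent modulo the Frattini subgroup, and
because the powers of the image of `d` that commute with the image of `x` are trivial. -/
theorem injective {P : Type*} [Group P] [Finite P] (h : SatisfiesSmallGroupRels x y d e)
    (hxy : Subgroup.closure {x, y} = ⊤) (hP : IsPGroup 3 P) (hc : ¬ IsCyclic P) (f : G →* P)
    (hf : Subgroup.closure {f x, f y} = ⊤) (he : f e ≠ 1) : Function.Injective f := by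
  have hp : Fact (Nat.Prime 3) := ⟨Nat.prime_three⟩
  have hd' := gcomm_eq_iff.mp h.gcomm_y_x
  have he' := gcomm_eq_iff.mp h.gcomm_d_x
  have hec : e ∈ Subgroup.center G :=
    Subgroup.mem_center_of_closure_pair hxy h.commute_e_x h.commute_e_y
  have hord : orderOf (f e) = 3 :=
    orderOf_eq_prime (by rw [← map_pow, h.e_cube, map_one]) he
  have h3 {n : ℤ} (hn : f e ^ n = 1) : (3 : ℤ) ∣ n := by
    rwa [← orderOf_dvd_iff_zpow_eq_one, hord] at hn
  have hdΦ : f d ∈ frattini P := by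
    rw [← h.gcomm_y_x, map_gcomm]
    exact hP.gcomm_mem_frattini _ _
  have heΦ : f e ∈ frattini P := by
    rw [← h.gcomm_d_x, map_gcomm]
    exact hP.gcomm_mem_frattini _ _
  rw [injective_iff_map_eq_one]
  intro g hg
  obtain ⟨i, j, k, l, rfl⟩ := exists_eq_zpow_mul_zpow hxy hd' he' h.commute_d_y hec g
  have hij : f x ^ i * f y ^ j ∈ frattini P := by
    simp only [map_mul, map_zpow] at hg
    rw [mul_assoc (f x ^ i * f y ^ j)] at hg
    rw [eq_inv_of_mul_eq_one_left hg]
    exact inv_mem (mul_mem (zpow_mem hdΦ k) (zpow_mem heΦ l))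
  obtain ⟨⟨i', hi⟩, ⟨j', hj⟩⟩ := hP.dvd_of_zpow_mul_zpow_mem_frattini hc hf hij
  have hxi : x ^ i = e ^ (2 * i') := by
    rw [hi, zpow_mul, zpow_natCast, h.x_cube, zpow_mul, zpow_ofNat]
  have hyj : y ^ j = e ^ (2 * j') := by
    rw [hj, zpow_mul, zpow_natCast, h.y_cube, zpow_mul, zpow_ofNat]
  have hE := Commute.of_mem_center hec
  have hrew : x ^ i * y ^ j * d ^ k * e ^ l = d ^ k * e ^ (2 * i' + 2 * j' + l) := by
    rw [hxi, hyj, ← zpow_add, ((hE d).zpow_zpow _ k).eq, mul_assoc, ← zpow_add]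
  rw [hrew] at hg ⊢
  generalize 2 * i' + 2 * j' + l = m at *
  have hk : (3 : ℤ) ∣ k := by
    apply h3
    have h4 : SemiconjBy x (d * e) d := by rw [SemiconjBy, ← mul_assoc, he']
    have h5 : x * (d * e) ^ k = d ^ k * x := h4.zpow_right k
    rw [(hE d).symm.mul_zpow] at h5
    have h6 := congrArg f h5
    simp only [map_mul, map_zpow] at h6 hg
    have h7 : Commute (f d ^ k) (f x) := by
      rw [eq_inv_of_mul_eq_one_left hg]
      exact (((hE x).map f).zpow_left m).inv_left
    rwa [h7.eq, mul_right_inj, mul_eq_left] at h6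
  rw [zpow_congr_of_cube_eq_one h.d_cube (b := 0) (by simpa using hk), zpow_zero, one_mul] at hg ⊢
  rw [map_zpow] at hg
  rw [zpow_congr_of_cube_eq_one h.e_cube (b := 0) (by simpa using h3 hg), zpow_zero]

end SatisfiesSmallGroupRels

namespace SmallGroup81_10

theorem satisfiesSmallGroupRels :
    SatisfiesSmallGroupRels (G := SmallGroup81_10) (PresentedGroup.of 0) (PresentedGroup.of 1)
      (PresentedGroup.of 2) (PresentedGroup.of 3) := by
  have key {r : FreeGroup (Fin 4)} (hr : r ∈ SmallGroup81x10.rels) :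
      PresentedGroup.mk SmallGroup81x10.rels r = 1 := PresentedGroup.one_of_mem hr
  have heq {a b : FreeGroup (Fin 4)} (hr : a * b⁻¹ ∈ SmallGroup81x10.rels) :
      PresentedGroup.mk SmallGroup81x10.rels a = PresentedGroup.mk SmallGroup81x10.rels b := by
    have := key hr
    rwa [map_mul, map_inv, mul_inv_eq_one] at this
  constructor
  · exact heq (a := SmallGroup81x10.b ^ 3) (b := SmallGroup81x10.e ^ 2)
      (by simp [SmallGroup81x10.rels])
  · exact heq (a := SmallGroup81x10.c ^ 3) (b := SmallGroup81x10.e ^ 2)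
      (by simp [SmallGroup81x10.rels])
  · exact key (r := SmallGroup81x10.d ^ 3) (by simp [SmallGroup81x10.rels])
  · exact key (r := SmallGroup81x10.e ^ 3) (by simp [SmallGroup81x10.rels])
  · exact heq (a := gcomm SmallGroup81x10.c SmallGroup81x10.b) (b := SmallGroup81x10.d)
      (by simp [SmallGroup81x10.rels])
  · exact heq (a := gcomm SmallGroup81x10.d SmallGroup81x10.b) (b := SmallGroup81x10.e)
      (by simp [SmallGroup81x10.rels])
  all_goals apply gcomm_eq_one_iff_commute.mp
  · exact key (r := gcomm SmallGroup81x10.d SmallGroup81x10.c) (by simp [SmallGroup81x10.rels])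
  · exact key (r := gcomm SmallGroup81x10.e SmallGroup81x10.b) (by simp [SmallGroup81x10.rels])
  · exact key (r := gcomm SmallGroup81x10.e SmallGroup81x10.c) (by simp [SmallGroup81x10.rels])
  · exact key (r := gcomm SmallGroup81x10.e SmallGroup81x10.d) (by simp [SmallGroup81x10.rels])

theorem closure_pair_eq_top :
    Subgroup.closure {(PresentedGroup.of 0 : SmallGroup81_10), PresentedGroup.of 1} = ⊤ := by
  have h := satisfiesSmallGroupRels
  rw [eq_top_iff, ← PresentedGroup.closure_range_of, Subgroup.closure_le]
  have hgc {H : Subgroup SmallGroup81_10} {s t : SmallGroup81_10} (hs : s ∈ H) (ht : t ∈ H) :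
      gcomm s t ∈ H := mul_mem (mul_mem (mul_mem (inv_mem hs) (inv_mem ht)) hs) ht
  set H := Subgroup.closure {(PresentedGroup.of 0 : SmallGroup81_10), PresentedGroup.of 1}
  have h0 : PresentedGroup.of 0 ∈ H := Subgroup.subset_closure (by simp)
  have h1 : PresentedGroup.of 1 ∈ H := Subgroup.subset_closure (by simp)
  have h2 : PresentedGroup.of 2 ∈ H := h.gcomm_y_x ▸ hgc h1 h0
  have h3 : PresentedGroup.of 3 ∈ H := h.gcomm_d_x ▸ hgc h2 h0
  rintro _ ⟨i, rfl⟩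
  fin_cases i
  exacts [h0, h1, h2, h3]

end SmallGroup81_10

theorem SatisfiesSmallGroupRels.nonempty_mulEquiv {P : Type*} [Group P] [Finite P] {x y d e : P}
    (h : SatisfiesSmallGroupRels x y d e) (hxy : Subgroup.closure {x, y} = ⊤) (hP : IsPGroup 3 P)
    (hc : ¬ IsCyclic P) (he : e ≠ 1) : Nonempty (P ≃* SmallGroup81_10) := by
  let f : SmallGroup81_10 →* P := PresentedGroup.toGroup h.lift_eq_one
  have h0 : f (PresentedGroup.of 0) = x := PresentedGroup.toGroup.of _
  have h1 : f (PresentedGroup.of 1) = y := PresentedGroup.toGroup.of _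
  have h3 : f (PresentedGroup.of 3) = e := PresentedGroup.toGroup.of _
  have hinj : Function.Injective f :=
    SmallGroup81_10.satisfiesSmallGroupRels.injective SmallGroup81_10.closure_pair_eq_top hP hc f
      (by rw [h0, h1, hxy]) (by rwa [h3])
  have hsurj : Function.Surjective f := by
    rw [← MonoidHom.range_eq_top, eq_top_iff, ← hxy, Subgroup.closure_le]
    rintro _ (rfl | rfl)
    · exact ⟨_, h0⟩
    · exact ⟨_, h1⟩
  exact ⟨(MulEquiv.ofBijective f ⟨hinj, hsurj⟩).symm⟩

theorem mainTheorem7 {P : Type*} [Group P] [Finite P] (q : ℕ) (α : MulAut P)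
    (h : IsMaximalPair 3 q 2 P α) :
    (IsElementaryAbelianGroup 3 P ∧ Nat.card P = 9) ∨
    (IsExtraspecialGroup 3 P ∧ Nat.card P = 27 ∧ Monoid.exponent P = 3) ∨
    Nonempty (P ≃* SmallGroup81_10) := by
  have hα := h.isInvertingPair
  obtain ⟨x₀, y₀, h₀⟩ := h.exists_isInvertedGenerators
  obtain ⟨x, y, hxy⟩ := h₀.exists_isNormalizedGenerators hα
  by_cases he : gcomm (gcomm y x) x = 1
  · obtain ⟨u, v, huv, hu, hv, hd3, hd⟩ := hxy.exists_cube_eq_one hα he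
    rw [← or_assoc]
    exact Or.inl
      (hα.isPGroup.classification_of_gcomm_mem_center hα.not_isCyclic huv hu hv hd3 hd)
  · obtain ⟨u, v, huv, hne, hu, hv⟩ := hxy.exists_cube_eq_sq hα he
    obtain ⟨hd3, he3, -⟩ := huv.cube_gcomm hα
    have hE := Commute.of_mem_center (huv.gcomm_gcomm_mem_center hα).1
    have hrels : SatisfiesSmallGroupRels u v (gcomm v u) (gcomm (gcomm v u) u) :=
      ⟨hu, hv, hd3, he3, rfl, rfl, huv.commute, hE _, hE _, hE _⟩
    exact Or.inr (Or.inr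
      (hrels.nonempty_mulEquiv huv.closure_eq_top hα.isPGroup hα.not_isCyclic hne))
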